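/- Let $\Gamma$ be a non-amenable finitely generated group and let $(y_n)_{n\ge 0}$ be a sequence going to infinity in $\Gamma$ (i.e. leaving every finite subset). Then there exists a probability measure $\mu$ on $\Gamma$ such that: 1. $\mu$ is admissible: its support generates $\Gamma$ as a semigroup; 2. $\mu$ is symmetric: $\mu(g^{-1})=\mu(g)$ for all $g\in\Gamma$; 3. $\mu$ has exponential tails: for the word distance of some finite generating set of $\Gamma$, there is $M>1$ such that $\mu(B(e,n)^c)\le M^{-n}$ for all large enough $n$, where $B(e,n)$ is the ball of radius $n$ centered at the identity $e$; 4. the Green function $G_\mu(x,y)=\sum_{k\ge 0}\mu^{k}(x^{-1}y)$, where $\mu^k$ is the $k$-fold convolution power of $\mu$, is finite for all $x,y\in\Gamma$; 5. $y_n$ does not converge in the Martin boundary $\partial_\mu\Gamma$: it is not true that for every $z\in\Gamma$ the sequence $K_{y_n}(z)=G_\mu(z,y_n)/G_\mu(e,y_n)$ converges as $n\to\infty$. -/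

import Mathlib

open Filter Topology
open scoped ENNReal Pointwise

/-- A discrete group is amenable if it carries a left-invariant finitely additive
probability measure defined on all of its subsets. -/
def IsAmenable (Γ : Type*) [Group Γ] : Prop :=
  ∃ m : Set Γ → ℝ≥0∞,
    m Set.univ = 1 ∧
    (∀ A B, Disjoint A B → m (A ∪ B) = m A + m B) ∧
    ∀ (g : Γ) (A : Set Γ), m (g • A) = m A

/-- Word length of `g` with respect to `S`: the least length of a word in the letters
`S ∪ S⁻¹` with product `g`. (Meaningful when `S` generates the group.) -/
noncomputable def wordLength {Γ : Type*} [Group Γ] (S : Set Γ) (g : Γ) : ℕ :=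
  sInf {n | ∃ w : List Γ, w.length = n ∧ (∀ a ∈ w, a ∈ S ∨ a⁻¹ ∈ S) ∧ w.prod = g}

namespace PMF

variable {Γ : Type*} [Group Γ]

/-- The support of `μ` generates the group as a semigroup. -/
def IsAdmissible (μ : PMF Γ) : Prop :=
  Subsemigroup.closure μ.support = ⊤

/-- `μ` is invariant under inversion. -/
def IsSymmetric (μ : PMF Γ) : Prop :=
  ∀ g, μ g⁻¹ = μ g

/-- Exponential tails: for some word distance (of a finite generating set `S`) there is
`M > 1` such that, for large enough `n`, the complement of the closed ball of radius `n`
around the identity has mass at most `M⁻ⁿ`. -/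
def HasExponentialTails (μ : PMF Γ) : Prop :=
  ∃ S : Set Γ, S.Finite ∧ Subgroup.closure S = ⊤ ∧
    ∃ M : ℝ, 1 < M ∧ ∀ᶠ n : ℕ in atTop,
      μ.toOuterMeasure {g | n < wordLength S g} ≤ ENNReal.ofReal ((M ^ n)⁻¹)

open Classical in
/-- The `n`-fold convolution power `μⁿ`: the law of the product of `n` independent
elements of law `μ`. -/
noncomputable def convPow (μ : PMF Γ) : ℕ → Γ → ℝ≥0∞
  | 0 => fun g => if g = 1 then 1 else 0
  | n + 1 => fun g => ∑' h : Γ, convPow μ n h * μ (h⁻¹ * g)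

/-- The Green function `G(x, y) = ∑ₙ μⁿ(x⁻¹ y)`, as an extended nonnegative number. -/
noncomputable def green (μ : PMF Γ) (x y : Γ) : ℝ≥0∞ :=
  ∑' n : ℕ, convPow μ n (x⁻¹ * y)

/-- The Martin kernel `K_y(z) = G(z, y) / G(e, y)` (for a finite Green function). -/
noncomputable def martinKernel (μ : PMF Γ) (y z : Γ) : ℝ :=
  (green μ z y).toReal / (green μ 1 y).toReal

/-- Convergence in the Martin boundary of a sequence `y` which goes to infinity in the group
(for a finite Green function): the Martin kernels `K_{y n}` converge pointwise. -/
def ConvergesInMartinBoundary (μ : PMF Γ) (y : ℕ → Γ) : Prop :=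
  ∀ z : Γ, ∃ l : ℝ, Tendsto (fun n => martinKernel μ (y n) z) atTop (𝓝 l)

end PMF

/-! The Green function of a walk with small `ℓ²` norm is dominated, at a well-chosen far point, by a
single jump, so rare long jumps can steer the Martin kernel. By Kesten's theorem, non-amenability
gives a finitely supported symmetric generating measure `μ₀` whose convolution operator has norm as
small as desired (`exists_opBound_of_not_isAmenable`). To it are added symmetric atoms of mass `ε k`
at points `w k`, where `w k` is `y (φ k)` for even `k` and `z⁻¹ * y (φ k)` for odd `k`, with `z ≠ 1`
fixed and `φ` sparse.

The masses are exponentially small in the length of `y (φ k)`, at a rate strictly between `c (k +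
1)` and `c k` (`exists_scales`). Since `c` decreases, the measure with only the first `k` atoms
still decays at rate `c k`, and its Green function near distance `|y (φ k)|` is negligible against
`ε k`. Since `c` stays above some `a > 1`, the full measure has exponential tails.

Trajectories using an atom of index at least `k` are counted in `ℓ²` (`tsum_iterConv_add_le`): a
lone jump contributes the atom itself, and longer ones at most a small multiple of `ε k` because the
norm is small. Hence the Green function is at least `ε k` at `w k`, and at most half of that at
comparable points other than `w k` and its inverse (`PerturbationData.tsum_iterConv_le`). Therefore
the Martin kernel at `z` is at most `1/2` for even `k` and at least `2` for odd `k`. -/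

/-! ### Convolution, `ℓ²` operator bounds and perturbation of convolution powers. -/

section Convolution

variable {Γ : Type*} [Group Γ]

/-- Convolution of nonnegative functions on a group. -/
noncomputable def convolve (f ν : Γ → ℝ≥0∞) (x : Γ) : ℝ≥0∞ :=
  ∑' h : Γ, f h * ν (h⁻¹ * x)

open Classical in
/-- Convolution powers of a nonnegative function on a group. -/
noncomputable def iterConv (ν : Γ → ℝ≥0∞) : ℕ → Γ → ℝ≥0∞
  | 0 => fun g => if g = 1 then 1 else 0
  | n + 1 => convolve (iterConv ν n) ν

/-- Right convolution by `ν` has norm at most `r` on `ℓ²`. -/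
def OpBound (ν : Γ → ℝ≥0∞) (r : ℝ≥0∞) : Prop :=
  ∀ f : Γ → ℝ≥0∞, ∑' x, convolve f ν x ^ 2 ≤ r ^ 2 * ∑' x, f x ^ 2

lemma convPow_eq_iterConv (μ : PMF Γ) (n : ℕ) : PMF.convPow μ n = iterConv μ n := by
  induction n with
  | zero => rfl
  | succ n ih => funext g; simp only [PMF.convPow, iterConv, convolve, ih]

lemma convolve_mono {f f' ν ν' : Γ → ℝ≥0∞} (hf : f ≤ f') (hν : ν ≤ ν') :
    convolve f ν ≤ convolve f' ν' :=
  fun _ => ENNReal.tsum_le_tsum fun _ => mul_le_mul' (hf _) (hν _)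

lemma iterConv_mono {ν ν' : Γ → ℝ≥0∞} (hν : ν ≤ ν') (n : ℕ) : iterConv ν n ≤ iterConv ν' n := by
  induction n with
  | zero => exact le_rfl
  | succ n ih => exact convolve_mono ih hν

lemma convolve_add_left (f f' ν : Γ → ℝ≥0∞) :
    convolve (f + f') ν = convolve f ν + convolve f' ν := by
  funext x
  simp [convolve, add_mul, ENNReal.tsum_add]

lemma convolve_add_right (f ν ν' : Γ → ℝ≥0∞) :
    convolve f (ν + ν') = convolve f ν + convolve f ν' := by
  funext x
  simp [convolve, mul_add, ENNReal.tsum_add]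

lemma iterConv_zero_convolve (ν ν' : Γ → ℝ≥0∞) : convolve (iterConv ν 0) ν' = ν' := by
  funext x
  rw [convolve, tsum_eq_single 1]
  · simp [iterConv]
  · intro h hh
    simp [iterConv, hh]

lemma iterConv_one (ν : Γ → ℝ≥0∞) : iterConv ν 1 = ν := iterConv_zero_convolve ν ν

lemma convolve_zero_right_iter (f ν : Γ → ℝ≥0∞) : convolve f (iterConv ν 0) = f := by
  funext x
  rw [convolve, tsum_eq_single x]
  · simp [iterConv]
  · intro h hh
    have : h⁻¹ * x ≠ 1 := fun h' => hh (inv_mul_eq_one.1 h')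
    simp [iterConv, this]

lemma convolve_assoc (f g k : Γ → ℝ≥0∞) :
    convolve (convolve f g) k = convolve f (convolve g k) := by
  funext x
  simp only [convolve, ← ENNReal.tsum_mul_right, ← ENNReal.tsum_mul_left]
  rw [ENNReal.tsum_comm]
  refine tsum_congr fun a => ?_
  rw [← (Equiv.mulLeft a).tsum_eq]
  refine tsum_congr fun b => ?_
  simp [mul_assoc]

lemma iterConv_succ' (ν : Γ → ℝ≥0∞) (n : ℕ) : iterConv ν (n + 1) = convolve ν (iterConv ν n) := by
  induction n with
  | zero => rw [iterConv_one, convolve_zero_right_iter]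
  | succ n ih =>
    calc iterConv ν (n + 2) = convolve (iterConv ν (n + 1)) ν := rfl
      _ = convolve ν (convolve (iterConv ν n) ν) := by rw [ih, convolve_assoc]

lemma convolve_inv (f g : Γ → ℝ≥0∞) (x : Γ) :
    convolve f g x⁻¹ = convolve (fun y => g y⁻¹) (fun y => f y⁻¹) x := by
  simp only [convolve]
  rw [← (Equiv.mulLeft x⁻¹).tsum_eq]
  refine tsum_congr fun a => ?_
  rw [mul_comm]
  simp [mul_assoc]

lemma iterConv_inv {ν : Γ → ℝ≥0∞} (hν : ∀ g, ν g⁻¹ = ν g) (n : ℕ) (g : Γ) :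
    iterConv ν n g⁻¹ = iterConv ν n g := by
  induction n generalizing g with
  | zero => by_cases h : g = 1 <;> simp [iterConv, h]
  | succ n ih =>
    rw [iterConv, convolve_inv, ← iterConv, iterConv_succ']
    simp only [hν, ih]

lemma tsum_convolve (f ν : Γ → ℝ≥0∞) :
    ∑' x, convolve f ν x = (∑' x, f x) * ∑' x, ν x := by
  simp only [convolve]
  rw [ENNReal.tsum_comm, ← ENNReal.tsum_mul_right]
  refine tsum_congr fun a => ?_
  rw [ENNReal.tsum_mul_left, ← (Equiv.mulLeft a⁻¹).tsum_eq ν]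
  rfl

lemma tsum_iterConv {ν : Γ → ℝ≥0∞} (hν : ∑' x, ν x = 1) (n : ℕ) :
    ∑' x, iterConv ν n x = 1 := by
  induction n with
  | zero => simp [iterConv]
  | succ n ih => rw [iterConv, tsum_convolve, ih, hν, one_mul]

lemma support_iterConv_finite {ν : Γ → ℝ≥0∞} (hν : ν.support.Finite) (n : ℕ) :
    (iterConv ν n).support.Finite := by
  induction n with
  | zero =>
    refine (Set.finite_singleton (1 : Γ)).subset fun g hg => ?_
    by_contra h
    exact hg (if_neg h)
  | succ n ih =>
    refine (ih.mul hν).subset fun g hg => ?_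
    by_contra h
    refine hg (ENNReal.tsum_eq_zero.2 fun a => ?_)
    by_contra h'
    rw [mul_eq_zero, not_or] at h'
    exact h ⟨a, h'.1, a⁻¹ * g, h'.2, by simp⟩

/-- A walk that may stay put keeps every point once reached in its support, so passing to a high
power does not destroy generation. -/
lemma iterConv_succ_ne_zero {ν : Γ → ℝ≥0∞} (h1 : ν 1 ≠ 0) {g : Γ} (hg : ν g ≠ 0) (n : ℕ) :
    iterConv ν (n + 1) g ≠ 0 := by
  induction n with
  | zero => rwa [iterConv_one]
  | succ n ih =>
    intro h
    have := ENNReal.tsum_eq_zero.1 h g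
    simp only [inv_mul_cancel, mul_eq_zero] at this
    exact this.elim ih h1

lemma ENNReal.two_mul_mul_le_sq_add_sq (a b : ℝ≥0∞) : 2 * (a * b) ≤ a ^ 2 + b ^ 2 := by
  wlog h : a ≤ b generalizing a b
  · rw [mul_comm a, add_comm]
    exact this b a (le_of_not_ge h)
  obtain ⟨c, rfl⟩ := exists_add_of_le h
  calc 2 * (a * (a + c)) ≤ 2 * (a * (a + c)) + c ^ 2 := le_self_add
    _ = _ := by ring

/-- Minkowski's inequality, for bounds written with squares. -/
lemma tsum_add_sq_le {ι : Type*} {a b : ι → ℝ≥0∞} {r s X : ℝ≥0∞} (hr : r ≠ 0) (hr' : r ≠ ∞)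
    (hs : s ≠ 0) (hs' : s ≠ ∞) (ha : ∑' i, a i ^ 2 ≤ r ^ 2 * X) (hb : ∑' i, b i ^ 2 ≤ s ^ 2 * X) :
    ∑' i, (a i + b i) ^ 2 ≤ (r + s) ^ 2 * X := by
  -- Multiplying by `r * s` and weighting the cross term as `(s a) (r b)` gives the sharp constant
  -- without square roots.
  have hpt : ∀ i, (r * s) * (a i + b i) ^ 2 ≤ (r + s) * (s * a i ^ 2 + r * b i ^ 2) := fun i => by
    calc (r * s) * (a i + b i) ^ 2
        = r * s * a i ^ 2 + r * s * b i ^ 2 + 2 * ((s * a i) * (r * b i)) := by ring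
      _ ≤ r * s * a i ^ 2 + r * s * b i ^ 2 + ((s * a i) ^ 2 + (r * b i) ^ 2) := by
        gcongr
        exact ENNReal.two_mul_mul_le_sq_add_sq _ _
      _ = _ := by ring
  have hsum : (r * s) * ∑' i, (a i + b i) ^ 2 ≤ (r * s) * ((r + s) ^ 2 * X) := by
    calc (r * s) * ∑' i, (a i + b i) ^ 2 ≤ ∑' i, (r + s) * (s * a i ^ 2 + r * b i ^ 2) := by
          rw [← ENNReal.tsum_mul_left]
          exact ENNReal.tsum_le_tsum hpt
      _ = (r + s) * (s * ∑' i, a i ^ 2 + r * ∑' i, b i ^ 2) := by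
          rw [ENNReal.tsum_mul_left, ENNReal.tsum_add, ENNReal.tsum_mul_left, ENNReal.tsum_mul_left]
      _ ≤ (r + s) * (s * (r ^ 2 * X) + r * (s ^ 2 * X)) := by gcongr
      _ = _ := by ring
  exact (ENNReal.mul_le_mul_iff_right (mul_ne_zero hr hs) (ENNReal.mul_ne_top hr' hs')).1 hsum

lemma OpBound.mono {ν ν' : Γ → ℝ≥0∞} {r r' : ℝ≥0∞} (h : OpBound ν' r) (hν : ν ≤ ν')
    (hr : r ≤ r') : OpBound ν r' := fun f =>
  calc ∑' x, convolve f ν x ^ 2 ≤ ∑' x, convolve f ν' x ^ 2 :=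
        ENNReal.tsum_le_tsum fun x => pow_le_pow_left' (convolve_mono le_rfl hν x) 2
    _ ≤ r ^ 2 * ∑' x, f x ^ 2 := h f
    _ ≤ r' ^ 2 * ∑' x, f x ^ 2 := by gcongr

lemma OpBound.add {ν ν' : Γ → ℝ≥0∞} {r s : ℝ≥0∞} (h : OpBound ν r) (h' : OpBound ν' s)
    (hr : r ≠ 0) (hr' : r ≠ ∞) (hs : s ≠ 0) (hs' : s ≠ ∞) : OpBound (ν + ν') (r + s) := fun f => by
  rw [convolve_add_right]
  exact tsum_add_sq_le hr hr' hs hs' (h f) (h' f)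

lemma OpBound.const_mul {ν : Γ → ℝ≥0∞} {r : ℝ≥0∞} (h : OpBound ν r) (c : ℝ≥0∞) :
    OpBound (fun g => c * ν g) (c * r) := fun f => by
  have : ∀ x, convolve f (fun g => c * ν g) x = c * convolve f ν x := fun x => by
    simp only [convolve, ← ENNReal.tsum_mul_left]
    exact tsum_congr fun _ => by ring
  simp only [this, mul_pow, ENNReal.tsum_mul_left, mul_assoc]
  gcongr
  exact h f

/-- A weighted Cauchy-Schwarz inequality. -/
lemma sq_tsum_mul_le {ι : Type*} (f p : ι → ℝ≥0∞) :
    (∑' i, f i * p i) ^ 2 ≤ (∑' i, p i) * ∑' i, f i ^ 2 * p i := by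
  have key : 2 * (∑' i, f i * p i) ^ 2 ≤ 2 * ((∑' i, p i) * ∑' i, f i ^ 2 * p i) := by
    calc 2 * (∑' i, f i * p i) ^ 2 = ∑' i, ∑' j, 2 * (f i * f j) * (p i * p j) := by
          simp only [sq, ← ENNReal.tsum_mul_left, ← ENNReal.tsum_mul_right]
          rw [ENNReal.tsum_comm]
          exact tsum_congr fun i => tsum_congr fun j => by ring
      _ ≤ ∑' i, ∑' j, (f i ^ 2 + f j ^ 2) * (p i * p j) :=
          ENNReal.tsum_le_tsum fun i => ENNReal.tsum_le_tsum fun j => by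
            gcongr
            exact ENNReal.two_mul_mul_le_sq_add_sq _ _
      _ = ∑' i, ∑' j, (f i ^ 2 * p i) * p j + ∑' i, ∑' j, p i * (f j ^ 2 * p j) := by
          rw [← ENNReal.tsum_add]
          refine tsum_congr fun i => ?_
          rw [← ENNReal.tsum_add]
          exact tsum_congr fun j => by ring
      _ = _ := by
          simp only [ENNReal.tsum_mul_left, ENNReal.tsum_mul_right]
          ring
  exact (ENNReal.mul_le_mul_iff_right two_ne_zero ENNReal.ofNat_ne_top).1 key

/-- Young's inequality: the norm of a convolution operator is at most the total mass. -/
lemma opBound_of_tsum_le {ν : Γ → ℝ≥0∞} {s : ℝ≥0∞} (hs : ∑' g, ν g ≤ s) : OpBound ν s := fun f => by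
  have hsum : ∀ x : Γ, ∑' h : Γ, ν (h⁻¹ * x) = ∑' g, ν g := fun x => by
    rw [← ((Equiv.inv Γ).trans (Equiv.mulRight x)).tsum_eq ν]
    rfl
  calc ∑' x, convolve f ν x ^ 2 ≤ ∑' x, (∑' g, ν g) * convolve (fun h => f h ^ 2) ν x :=
        ENNReal.tsum_le_tsum fun x => by
          rw [← hsum x]
          exact sq_tsum_mul_le f fun h => ν (h⁻¹ * x)
    _ = (∑' g, ν g) ^ 2 * ∑' x, f x ^ 2 := by
        rw [ENNReal.tsum_mul_left, tsum_convolve]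
        ring
    _ ≤ s ^ 2 * ∑' x, f x ^ 2 := by gcongr

lemma tsum_iterConv_zero_sq (ν : Γ → ℝ≥0∞) : ∑' x, iterConv ν 0 x ^ 2 = 1 := by
  rw [tsum_eq_single 1] <;> simp +contextual [iterConv]

lemma OpBound.tsum_iterConv_sq_le {ν : Γ → ℝ≥0∞} {r : ℝ≥0∞} (h : OpBound ν r) (n : ℕ) :
    ∑' x, iterConv ν n x ^ 2 ≤ (r ^ n) ^ 2 := by
  induction n with
  | zero => rw [tsum_iterConv_zero_sq]; simp
  | succ n ih =>
    calc ∑' x, iterConv ν (n + 1) x ^ 2 ≤ r ^ 2 * ∑' x, iterConv ν n x ^ 2 := h _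
      _ ≤ r ^ 2 * (r ^ n) ^ 2 := by gcongr
      _ = _ := by ring

lemma le_of_tsum_sq_le {ι : Type*} {f : ι → ℝ≥0∞} {c : ℝ≥0∞} (h : ∑' i, f i ^ 2 ≤ c ^ 2) (i : ι) :
    f i ≤ c :=
  (ENNReal.pow_le_pow_left_iff two_ne_zero).1 ((ENNReal.le_tsum i).trans h)

/-- The Dirac mass at `1` has unit `ℓ²` norm, and a value never exceeds the `ℓ²` norm. -/
lemma OpBound.iterConv_le {ν : Γ → ℝ≥0∞} {r : ℝ≥0∞} (h : OpBound ν r) (n : ℕ) (g : Γ) :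
    iterConv ν n g ≤ r ^ n :=
  le_of_tsum_sq_le (h.tsum_iterConv_sq_le n) g

lemma OpBound.iterConv {ν : Γ → ℝ≥0∞} {r : ℝ≥0∞} (h : OpBound ν r) (n : ℕ) :
    OpBound (iterConv ν n) (r ^ n) := fun f => by
  induction n with
  | zero => rw [convolve_zero_right_iter]; simp
  | succ n ih =>
    rw [_root_.iterConv, ← convolve_assoc]
    calc _ ≤ r ^ 2 * ∑' x, convolve f (_root_.iterConv ν n) x ^ 2 := h _
      _ ≤ r ^ 2 * ((r ^ n) ^ 2 * ∑' x, f x ^ 2) := by gcongr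
      _ = _ := by ring

/-- Convolution powers and submultiplicative weights. -/
lemma iterConv_mul_le {ω : Γ → ℝ≥0∞} (h1 : ω 1 ≤ 1) (hω : ∀ g h, ω (g * h) ≤ ω g * ω h)
    (ν : Γ → ℝ≥0∞) (n : ℕ) (g : Γ) :
    iterConv ν n g * ω g ≤ iterConv (fun g => ν g * ω g) n g := by
  induction n generalizing g with
  | zero => by_cases hg : g = 1 <;> simp [iterConv, hg, h1]
  | succ n ih =>
    simp only [iterConv, convolve, ← ENNReal.tsum_mul_right]
    refine ENNReal.tsum_le_tsum fun h => ?_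
    calc iterConv ν n h * ν (h⁻¹ * g) * ω g
        = iterConv ν n h * ν (h⁻¹ * g) * ω (h * (h⁻¹ * g)) := by simp
      _ ≤ iterConv ν n h * ν (h⁻¹ * g) * (ω h * ω (h⁻¹ * g)) := by gcongr; exact hω _ _
      _ = (iterConv ν n h * ω h) * (ν (h⁻¹ * g) * ω (h⁻¹ * g)) := by ring
      _ ≤ _ := by gcongr; exact ih h

/-- The part of `(A + R)ⁿ` which uses `R` at least once. -/
noncomputable def iterDiff (A R : Γ → ℝ≥0∞) : ℕ → Γ → ℝ≥0∞
  | 0 => 0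
  | n + 1 => convolve (iterDiff A R n) (A + R) + convolve (iterConv A n) R

lemma iterConv_add (A R : Γ → ℝ≥0∞) (n : ℕ) :
    iterConv (A + R) n = iterConv A n + iterDiff A R n := by
  induction n with
  | zero => simp [iterDiff, iterConv]
  | succ n ih =>
    rw [iterConv, ih, convolve_add_left, iterDiff, iterConv, convolve_add_right (iterConv A n)]
    abel

lemma iterDiff_one (A R : Γ → ℝ≥0∞) : iterDiff A R 1 = R := by
  have h0 : convolve (0 : Γ → ℝ≥0∞) (A + R) = 0 := by
    funext x
    simp [convolve]
  simp only [iterDiff, h0, iterConv_zero_convolve, zero_add]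

/-- Splitting by the first use of `R` gives `n + 1` terms `Aʲ R (A + R)ⁿ⁻ʲ`, each of norm at most `s
rⁿ`. The factor `2ⁿ` absorbs their number. -/
lemma tsum_iterDiff_sq_le {A R : Γ → ℝ≥0∞} {r s : ℝ≥0∞} (hA : OpBound (A + R) r)
    (hR : OpBound R s) (hr : r ≠ 0) (hr' : r ≠ ∞) (hs : s ≠ 0) (hs' : s ≠ ∞) (n : ℕ) :
    ∑' x, iterDiff A R (n + 1) x ^ 2 ≤ (s * (2 * r) ^ n) ^ 2 := by
  induction n with
  | zero =>
    have := hR (iterConv A 0)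
    rw [iterConv_zero_convolve, tsum_iterConv_zero_sq] at this
    rw [zero_add, iterDiff_one]
    simpa using this
  | succ n ih =>
    have h1 : ∑' x, convolve (iterDiff A R (n + 1)) (A + R) x ^ 2
        ≤ (r * (s * (2 * r) ^ n)) ^ 2 * 1 :=
      calc _ ≤ r ^ 2 * ∑' x, iterDiff A R (n + 1) x ^ 2 := hA _
        _ ≤ r ^ 2 * (s * (2 * r) ^ n) ^ 2 := by gcongr
        _ = _ := by ring
    have h2 : ∑' x, convolve (iterConv A (n + 1)) R x ^ 2 ≤ (s * r ^ (n + 1)) ^ 2 * 1 :=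
      calc _ ≤ s ^ 2 * ∑' x, iterConv A (n + 1) x ^ 2 := hR _
        _ ≤ s ^ 2 * (r ^ (n + 1)) ^ 2 := by
          gcongr
          exact (hA.mono le_self_add le_rfl).tsum_iterConv_sq_le _
        _ = _ := by ring
    have h3 : (2 : ℝ≥0∞) * r ≠ ∞ := ENNReal.mul_ne_top (by simp) hr'
    have h := tsum_add_sq_le (by positivity) (by finiteness) (by positivity) (by finiteness) h1 h2
    rw [iterDiff]
    refine h.trans ?_
    rw [mul_one]
    refine pow_le_pow_left' ?_ 2
    calc r * (s * (2 * r) ^ n) + s * r ^ (n + 1)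
        ≤ r * (s * (2 * r) ^ n) + s * r ^ (n + 1) * 2 ^ n :=
          add_le_add le_rfl (le_mul_of_one_le_right' (one_le_pow₀ one_le_two))
      _ = s * (2 * r) ^ (n + 1) := by ring

lemma ENNReal.tsum_eq_add_add_tsum (f : ℕ → ℝ≥0∞) :
    ∑' n, f n = f 0 + f 1 + ∑' n, f (n + 2) := by
  rw [tsum_eq_zero_add' ENNReal.summable, tsum_eq_zero_add' ENNReal.summable, add_assoc]

/-- Green function bound for a perturbation `A + R` of `A`. -/
lemma tsum_iterConv_add_le {A R : Γ → ℝ≥0∞} {r s : ℝ≥0∞} (hA : OpBound (A + R) r)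
    (hR : OpBound R s) (hr : r ≠ 0) (hr' : r ≠ ∞) (hs : s ≠ 0) (hs' : s ≠ ∞) (g : Γ) :
    ∑' n, iterConv (A + R) n g ≤
      (∑' n, iterConv A n g) + R g + s * ∑' n : ℕ, (2 * r) ^ (n + 1) := by
  have hsplit : ∑' n, iterDiff A R n g = R g + ∑' n, iterDiff A R (n + 2) g := by
    rw [ENNReal.tsum_eq_add_add_tsum, iterDiff_one]
    simp only [iterDiff, Pi.zero_apply, zero_add]
  simp only [iterConv_add, Pi.add_apply]
  rw [ENNReal.tsum_add, hsplit, add_assoc, ← ENNReal.tsum_mul_left]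
  refine add_le_add le_rfl (add_le_add le_rfl (ENNReal.tsum_le_tsum fun n => ?_))
  exact le_of_tsum_sq_le (tsum_iterDiff_sq_le hA hR hr hr' hs hs' (n + 1)) g

end Convolution

/-! ### Kesten's theorem. -/

section Kesten

variable {Γ : Type*} [Group Γ]

open Classical in
/-- The uniform probability on a finite set. -/
noncomputable def uniformOn {α : Type*} (T : Finset α) (g : α) : ℝ≥0∞ :=
  if g ∈ T then (T.card : ℝ≥0∞)⁻¹ else 0

lemma tsum_uniformOn {α : Type*} {T : Finset α} (hT : T.Nonempty) : ∑' g, uniformOn T g = 1 := by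
  have h : ∑ g ∈ T, uniformOn T g = ∑ g ∈ T, (T.card : ℝ≥0∞)⁻¹ :=
    Finset.sum_congr rfl fun g hg => if_pos hg
  have h' : ∑' g, uniformOn T g = ∑ g ∈ T, uniformOn T g := tsum_eq_sum fun g hg => if_neg hg
  rw [h', h, Finset.sum_const, nsmul_eq_mul]
  exact ENNReal.mul_inv_cancel (by simpa using hT.ne_empty) (ENNReal.natCast_ne_top _)

lemma uniformOn_ne_zero {α : Type*} {T : Finset α} {g : α} : uniformOn T g ≠ 0 ↔ g ∈ T := by
  by_cases h : g ∈ T <;> simp [uniformOn, h]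

lemma uniformOn_inv {T : Finset Γ} (hT : ∀ t ∈ T, t⁻¹ ∈ T) (g : Γ) :
    uniformOn T g⁻¹ = uniformOn T g := by
  have : g⁻¹ ∈ T ↔ g ∈ T := ⟨fun h => by simpa using hT _ h, hT g⟩
  by_cases h : g ∈ T
  · rw [uniformOn, uniformOn, if_pos h, if_pos (this.2 h)]
  · rw [uniformOn, uniformOn, if_neg h, if_neg (this.not.2 h)]

lemma convolve_uniformOn {T : Finset Γ} (hT : ∀ t ∈ T, t⁻¹ ∈ T) (f : Γ → ℝ≥0∞) (x : Γ) :
    convolve f (uniformOn T) x = (T.card : ℝ≥0∞)⁻¹ * ∑ t ∈ T, f (x * t) := by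
  rw [convolve, ← (Equiv.mulLeft x).tsum_eq, tsum_eq_sum (s := T), Finset.mul_sum]
  · refine Finset.sum_congr rfl fun t ht => ?_
    have : (x * t)⁻¹ * x = t⁻¹ := by group
    rw [Equiv.coe_mulLeft, this, uniformOn_inv hT, uniformOn, if_pos ht, mul_comm]
  · intro t ht
    have : (x * t)⁻¹ * x = t⁻¹ := by group
    rw [Equiv.coe_mulLeft, this, uniformOn_inv hT, uniformOn, if_neg ht, mul_zero]

/-- The defect in Cauchy–Schwarz is half the double sum of `(a k - a l) ^ 2`, of which one term is
kept. -/
lemma sq_sum_add_sq_sub_le {ι : Type*} (T : Finset ι) (a : ι → ℝ) {i j : ι} (hi : i ∈ T)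
    (hj : j ∈ T) :
    (∑ k ∈ T, a k) ^ 2 + (a i - a j) ^ 2 / 2 ≤ T.card * ∑ k ∈ T, a k ^ 2 := by
  have h1 : ∑ k ∈ T, ∑ l ∈ T, (a k - a l) ^ 2 =
      2 * (T.card * ∑ k ∈ T, a k ^ 2) - 2 * (∑ k ∈ T, a k) ^ 2 := by
    have : ∀ k l, (a k - a l) ^ 2 = a k ^ 2 + a l ^ 2 - 2 * (a k * a l) := fun k l => by ring
    simp only [this, Finset.sum_sub_distrib, Finset.sum_add_distrib, Finset.sum_const,
      nsmul_eq_mul, ← Finset.mul_sum, ← Finset.sum_mul]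
    ring
  have h2 : (a i - a j) ^ 2 ≤ ∑ k ∈ T, ∑ l ∈ T, (a k - a l) ^ 2 :=
    (Finset.single_le_sum (f := fun l => (a i - a l) ^ 2) (fun _ _ => sq_nonneg _) hj).trans
      (Finset.single_le_sum (f := fun k => ∑ l ∈ T, (a k - a l) ^ 2)
        (fun _ _ => Finset.sum_nonneg fun _ _ => sq_nonneg _) hi)
  linarith

/-- The loss of norm under averaging controls the displacement by the elements of `T`. -/
lemma tsum_convolve_uniformOn_add_le {T : Finset Γ} (hT : ∀ t ∈ T, t⁻¹ ∈ T) (h1 : 1 ∈ T)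
    {t : Γ} (ht : t ∈ T) {F : Γ → ℝ} (hF : ∀ x, 0 ≤ F x) :
    ∑' x, convolve (fun x => ENNReal.ofReal (F x)) (uniformOn T) x ^ 2 +
      ENNReal.ofReal (1 / (2 * T.card ^ 2)) * ∑' x, ENNReal.ofReal ((F (x * t) - F x) ^ 2) ≤
    ∑' x, ENNReal.ofReal (F x) ^ 2 := by
  have hc : (0 : ℝ) < T.card := by exact_mod_cast Finset.card_pos.2 ⟨1, h1⟩
  have hpt : ∀ x, convolve (fun x => ENNReal.ofReal (F x)) (uniformOn T) x ^ 2 +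
      ENNReal.ofReal (1 / (2 * T.card ^ 2)) * ENNReal.ofReal ((F (x * t) - F x) ^ 2) ≤
      (T.card : ℝ≥0∞)⁻¹ * ∑ s ∈ T, ENNReal.ofReal (F (x * s)) ^ 2 := fun x => by
    rw [convolve_uniformOn hT, ← ENNReal.ofReal_sum_of_nonneg fun _ _ => hF _]
    have hsum : 0 ≤ ∑ s ∈ T, F (x * s) := Finset.sum_nonneg fun _ _ => hF _
    have hci : (T.card : ℝ≥0∞)⁻¹ = ENNReal.ofReal (T.card : ℝ)⁻¹ := by
      rw [ENNReal.ofReal_inv_of_pos hc, ENNReal.ofReal_natCast]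
    simp_rw [← ENNReal.ofReal_pow (hF _)]
    rw [hci, ← ENNReal.ofReal_mul (by positivity), ← ENNReal.ofReal_mul (by positivity),
      ← ENNReal.ofReal_pow (by positivity), ← ENNReal.ofReal_sum_of_nonneg (fun _ _ => sq_nonneg _),
      ← ENNReal.ofReal_mul (by positivity), ← ENNReal.ofReal_add (by positivity) (by positivity)]
    refine ENNReal.ofReal_le_ofReal ?_
    have := sq_sum_add_sq_sub_le T (fun s => F (x * s)) ht h1
    simp only [mul_one] at this
    have h2 := mul_le_mul_of_nonneg_left this (by positivity : 0 ≤ ((T.card : ℝ) ^ 2)⁻¹)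
    refine le_trans (le_of_eq ?_) (h2.trans (le_of_eq ?_)) <;> field_simp
  calc _ = ∑' x, (convolve (fun x => ENNReal.ofReal (F x)) (uniformOn T) x ^ 2 +
      ENNReal.ofReal (1 / (2 * T.card ^ 2)) * ENNReal.ofReal ((F (x * t) - F x) ^ 2)) := by
        rw [ENNReal.tsum_add, ENNReal.tsum_mul_left]
    _ ≤ ∑' x, (T.card : ℝ≥0∞)⁻¹ * ∑ s ∈ T, ENNReal.ofReal (F (x * s)) ^ 2 :=
        ENNReal.tsum_le_tsum hpt
    _ = (T.card : ℝ≥0∞)⁻¹ * ∑ s ∈ T, ∑' x, ENNReal.ofReal (F x) ^ 2 := by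
        rw [ENNReal.tsum_mul_left, Summable.tsum_finsetSum fun _ _ => ENNReal.summable]
        congr 1
        exact Finset.sum_congr rfl fun s _ =>
          (Equiv.mulRight s).tsum_eq fun x => ENNReal.ofReal (F x) ^ 2
    _ = _ := by
        rw [Finset.sum_const, nsmul_eq_mul, ← mul_assoc, ENNReal.inv_mul_cancel, one_mul]
        · exact_mod_cast hc.ne'
        · exact ENNReal.natCast_ne_top _

/-- The factor on `b ^ 2` can be taken arbitrarily close to `1`, at the price of a large factor on
the difference, which is harmless when the difference tends to `0`. -/
lemma ofReal_sq_le_add {a b η : ℝ} (hη : 0 < η) :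
    ENNReal.ofReal (a ^ 2) ≤ ENNReal.ofReal (1 + η) * ENNReal.ofReal (b ^ 2) +
      ENNReal.ofReal (1 + 1 / η) * ENNReal.ofReal ((a - b) ^ 2) := by
  rw [← ENNReal.ofReal_mul (by positivity), ← ENNReal.ofReal_mul (by positivity),
    ← ENNReal.ofReal_add (by positivity) (by positivity)]
  refine ENNReal.ofReal_le_ofReal ?_
  have h : 0 ≤ (η * b - (a - b)) ^ 2 / η := by positivity
  have h' : (1 + η) * b ^ 2 + (1 + 1 / η) * (a - b) ^ 2 - a ^ 2 = (η * b - (a - b)) ^ 2 / η := by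
    field_simp
    ring
  linarith

/-- A sequence of almost invariant densities yields an invariant mean. -/
lemma isAmenable_of_tendsto {S : Set Γ} (hS : Submonoid.closure S = ⊤) (p : ℕ → Γ → ℝ)
    (hp : ∀ n, ∑' x, ENNReal.ofReal (p n x ^ 2) = 1)
    (hlim : ∀ t ∈ S, Tendsto (fun n => ∑' x, ENNReal.ofReal ((p n (x * t) - p n x) ^ 2)) atTop (𝓝 0)) :
    IsAmenable Γ := by
  classical
  -- The inverse turns almost invariance under right translation into left invariance of the limit.
  let q : ℕ → Set Γ → ℝ≥0∞ := fun n A => ∑' x, (if x⁻¹ ∈ A then 1 else 0) * ENNReal.ofReal (p n x ^ 2)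
  let U : Ultrafilter ℕ := hyperfilter ℕ
  have hU : (U : Filter ℕ) ≤ atTop := Nat.hyperfilter_le_atTop
  have hex : ∀ A, ∃ a, Tendsto (fun n => q n A) U (𝓝 a) := fun A => by
    obtain ⟨a, -, ha⟩ := isCompact_univ.ultrafilter_le_nhds (U.map fun n => q n A) (by simp)
    exact ⟨a, ha⟩
  choose m hm using hex
  have hadd : ∀ A B, Disjoint A B → m (A ∪ B) = m A + m B := fun A B hAB => by
    refine tendsto_nhds_unique (hm _) (((hm A).add (hm B)).congr fun n => ?_)
    rw [← ENNReal.tsum_add]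
    refine tsum_congr fun x => ?_
    rw [← add_mul]
    congr 1
    by_cases hA : x⁻¹ ∈ A
    · simp [hA, Set.disjoint_left.1 hAB hA]
    · simp [hA]
  have huniv : m Set.univ = 1 :=
    tendsto_nhds_unique (hm _) (tendsto_const_nhds.congr fun n => by simp [q, hp])
  have hfin : ∀ A, m A ≠ ∞ := fun A h => by
    have := hadd A Aᶜ disjoint_compl_right
    rw [Set.union_compl_self, huniv, h, top_add] at this
    exact ENNReal.one_ne_top this
  -- An inequality suffices: it passes to products, and applied to both `g` and `g⁻¹` it becomes an
  -- equality.
  have hstep : ∀ t ∈ S, ∀ A, m (t⁻¹ • A) ≤ m A := fun t ht A => by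
    have key : ∀ k : ℕ, m (t⁻¹ • A) ≤ ENNReal.ofReal (1 + 1 / (k + 1)) * m A := fun k => by
      set η : ℝ := 1 / (k + 1) with hη
      have hη0 : 0 < η := by positivity
      have hq : ∀ n, q n (t⁻¹ • A) ≤ ENNReal.ofReal (1 + η) * q n A +
          ENNReal.ofReal (1 + 1 / η) * ∑' x, ENNReal.ofReal ((p n (x * t) - p n x) ^ 2) := fun n => by
        simp only [q]
        rw [← (Equiv.mulRight t).tsum_eq, ← ENNReal.tsum_mul_left, ← ENNReal.tsum_mul_left,
          ← ENNReal.tsum_add]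
        refine ENNReal.tsum_le_tsum fun x => ?_
        by_cases hx : x⁻¹ ∈ A
        · have : (x * t)⁻¹ ∈ t⁻¹ • A := by simpa [Set.mem_smul_set_iff_inv_smul_mem] using hx
          rw [Equiv.coe_mulRight, if_pos this, if_pos hx, one_mul, one_mul]
          exact ofReal_sq_le_add hη0
        · have : (x * t)⁻¹ ∉ t⁻¹ • A := by simpa [Set.mem_smul_set_iff_inv_smul_mem] using hx
          rw [Equiv.coe_mulRight, if_neg this, zero_mul]
          exact zero_le
      have h1 := (ENNReal.Tendsto.const_mul (a := ENNReal.ofReal (1 + η)) (hm A)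
        (Or.inr ENNReal.ofReal_ne_top)).add
        (ENNReal.Tendsto.const_mul (a := ENNReal.ofReal (1 + 1 / η)) ((hlim t ht).mono_left hU)
          (Or.inr ENNReal.ofReal_ne_top))
      have := le_of_tendsto_of_tendsto' (hm _) h1 hq
      simpa using this
    have hl : Tendsto (fun k : ℕ => ENNReal.ofReal (1 + 1 / ((k : ℝ) + 1)) * m A) atTop
        (𝓝 (ENNReal.ofReal (1 + 0) * m A)) :=
      ENNReal.Tendsto.mul_const (ENNReal.tendsto_ofReal
        (tendsto_const_nhds.add tendsto_one_div_add_atTop_nhds_zero_nat)) (Or.inl (by simp))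
    simpa using ge_of_tendsto' hl key
  have hle : ∀ t : Γ, ∀ A, m (t⁻¹ • A) ≤ m A := fun t => by
    have : t ∈ Submonoid.closure S := hS ▸ Submonoid.mem_top t
    induction this using Submonoid.closure_induction with
    | mem t ht => exact hstep t ht
    | one => simp
    | mul a b _ _ ha hb =>
      intro A
      rw [mul_inv_rev, mul_smul]
      exact (hb _).trans (ha A)
  refine ⟨m, huniv, hadd, fun g A => le_antisymm (by simpa using hle g⁻¹ A) ?_⟩
  simpa using hle g (g • A)

/-- **Kesten's theorem**: on a nonamenable group, averaging operators contract `ℓ²`. -/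
theorem exists_opBound_uniformOn (hΓ : ¬ IsAmenable Γ) {T : Finset Γ} (hT : ∀ t ∈ T, t⁻¹ ∈ T)
    (h1 : 1 ∈ T) (hcl : Submonoid.closure (T : Set Γ) = ⊤) :
    ∃ ρ : ℝ≥0∞, ρ < 1 ∧ OpBound (uniformOn T) ρ := by
  by_contra! hcon
  refine hΓ ?_
  have hc : (0 : ℝ) < T.card := by exact_mod_cast Finset.card_pos.2 ⟨1, h1⟩
  -- If no bound below `1` holds, functions `f n` nearly keep their norm as `ρ n` tends to `1`. The
  -- variance defect then bounds their normalized displacement by `κ⁻¹ * (1 - ρ n ^ 2)`, so they are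
  -- almost invariant.
  obtain ⟨ρ, -, hρ1, hρ⟩ := exists_seq_strictMono_tendsto' (zero_lt_one' ℝ≥0∞)
  have hex : ∀ n, ∃ f : Γ → ℝ≥0∞,
      ρ n ^ 2 * ∑' x, f x ^ 2 < ∑' x, convolve f (uniformOn T) x ^ 2 := fun n => by
    have := hcon (ρ n) (hρ1 n).2
    rw [OpBound] at this
    push Not at this
    exact this
  choose f hf using hex
  have hρ0 : ∀ n, ρ n ≠ 0 := fun n => (hρ1 n).1.ne'
  have hfin : ∀ n, ∑' x, f n x ^ 2 ≠ ∞ := fun n h => by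
    have := hf n
    rw [h, ENNReal.mul_top (pow_ne_zero 2 (hρ0 n))] at this
    exact not_top_lt this
  set X : ℕ → ℝ≥0∞ := fun n => ∑' x, f n x ^ 2 with hX
  have hfx : ∀ n x, f n x ≠ ∞ := fun n x h =>
    ENNReal.ne_top_of_tsum_ne_top (hfin n) x (by simp [h])
  let F : ℕ → Γ → ℝ := fun n x => (f n x).toReal
  have hF : ∀ n x, 0 ≤ F n x := fun n x => ENNReal.toReal_nonneg
  have hFf : ∀ n, (fun x => ENNReal.ofReal (F n x)) = f n := fun n =>
    funext fun x => ENNReal.ofReal_toReal (hfx n x)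
  have hFf' : ∀ n x, ENNReal.ofReal (F n x) = f n x := fun n x => congrFun (hFf n) x
  set κ := ENNReal.ofReal (1 / (2 * T.card ^ 2)) with hκ
  have hκ0 : κ ≠ 0 := by
    rw [hκ, Ne, ENNReal.ofReal_eq_zero, not_le]
    positivity
  have hκt : κ ≠ ∞ := ENNReal.ofReal_ne_top
  have hineq : ∀ n, ∀ t ∈ T, ρ n ^ 2 * X n + κ * ∑' x, ENNReal.ofReal ((F n (x * t) - F n x) ^ 2) ≤ X n :=
    fun n t ht => by
      have := tsum_convolve_uniformOn_add_le hT h1 ht (hF n)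
      simp only [hFf'] at this
      exact le_trans (by gcongr; exact (hf n).le) this
  have hX0 : ∀ n, X n ≠ 0 := fun n h => by
    have h2 := tsum_convolve_uniformOn_add_le hT h1 h1 (hF n)
    simp only [hFf'] at h2
    have h3 : ρ n ^ 2 * X n < X n := (hf n).trans_le (le_self_add.trans h2)
    simp [h] at h3
  let c : ℕ → ℝ := fun n => √((X n).toReal)⁻¹
  have hXpos : ∀ n, 0 < (X n).toReal := fun n => ENNReal.toReal_pos (hX0 n) (hfin n)
  have hc2 : ∀ n (a : ℝ), ENNReal.ofReal ((c n * a) ^ 2) = (X n)⁻¹ * ENNReal.ofReal (a ^ 2) :=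
    fun n a => by
      rw [mul_pow, Real.sq_sqrt (inv_nonneg.2 (hXpos n).le),
        ENNReal.ofReal_mul (inv_nonneg.2 (hXpos n).le), ENNReal.ofReal_inv_of_pos (hXpos n),
        ENNReal.ofReal_toReal (hfin n)]
  refine isAmenable_of_tendsto hcl (fun n x => c n * F n x) (fun n => ?_) fun t ht => ?_
  · simp only [hc2, ENNReal.tsum_mul_left]
    simp only [ENNReal.ofReal_pow (hF _ _), hFf']
    exact ENNReal.inv_mul_cancel (hX0 n) (hfin n)
  · simp only [← mul_sub, hc2, ENNReal.tsum_mul_left]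
    have hup : ∀ n, (X n)⁻¹ * ∑' x, ENNReal.ofReal ((F n (x * t) - F n x) ^ 2) ≤
        κ⁻¹ * (1 - ρ n ^ 2) := fun n => by
      have h2 : κ * ∑' x, ENNReal.ofReal ((F n (x * t) - F n x) ^ 2) ≤ X n * (1 - ρ n ^ 2) := by
        rw [ENNReal.mul_sub fun _ _ => hfin n, mul_one]
        refine ENNReal.le_sub_of_add_le_left (ENNReal.mul_ne_top (hfin n) ?_) ?_
        · exact ENNReal.pow_ne_top (hρ1 n).2.ne_top
        · rw [mul_comm (X n)]
          exact hineq n t ht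
      calc (X n)⁻¹ * ∑' x, ENNReal.ofReal ((F n (x * t) - F n x) ^ 2)
          = (X n)⁻¹ * (κ⁻¹ * (κ * ∑' x, ENNReal.ofReal ((F n (x * t) - F n x) ^ 2))) := by
            rw [← mul_assoc κ⁻¹, ENNReal.inv_mul_cancel hκ0 hκt, one_mul]
        _ ≤ (X n)⁻¹ * (κ⁻¹ * (X n * (1 - ρ n ^ 2))) := by gcongr
        _ = ((X n)⁻¹ * X n) * (κ⁻¹ * (1 - ρ n ^ 2)) := by ring
        _ = _ := by rw [ENNReal.inv_mul_cancel (hX0 n) (hfin n), one_mul]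
    have hz : Tendsto (fun n => κ⁻¹ * (1 - ρ n ^ 2)) atTop (𝓝 0) := by
      have h3 : Tendsto (fun n => 1 - ρ n ^ 2) atTop (𝓝 (1 - 1 ^ 2)) :=
        ENNReal.Tendsto.sub tendsto_const_nhds (ENNReal.Tendsto.pow hρ) (Or.inl ENNReal.one_ne_top)
      have := ENNReal.Tendsto.const_mul (a := κ⁻¹) h3 (Or.inr (ENNReal.inv_ne_top.2 hκ0))
      simpa using this
    exact tendsto_of_tendsto_of_tendsto_of_le_of_le tendsto_const_nhds hz (fun _ => zero_le) hup

end Kesten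

/-! ### The base measure. -/

section Base

variable {Γ : Type*} [Group Γ]

lemma Subsemigroup.closure_eq_top_of_submonoid {S : Set Γ} (h1 : (1 : Γ) ∈ S)
    (hS : Submonoid.closure S = ⊤) : Subsemigroup.closure S = ⊤ := by
  refine eq_top_iff.2 fun g _ => ?_
  have : g ∈ Submonoid.closure S := hS ▸ Submonoid.mem_top g
  induction this using Submonoid.closure_induction with
  | mem t ht => exact Subsemigroup.subset_closure ht
  | one => exact Subsemigroup.subset_closure h1
  | mul a b _ _ ha hb => exact mul_mem (ha trivial) (hb trivial)

/-- A nonamenable group carries finitely supported symmetric probabilities of arbitrarily small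
convolution norm, whose support contains the identity and generates. -/
lemma exists_opBound_of_not_isAmenable (hΓ : ¬ IsAmenable Γ) {S : Set Γ} (hS : S.Finite)
    (hcl : Subgroup.closure S = ⊤) {δ : ℝ≥0∞} (hδ : δ ≠ 0) :
    ∃ μ : Γ → ℝ≥0∞, ∑' g, μ g = 1 ∧ (∀ g, μ g⁻¹ = μ g) ∧ μ.support.Finite ∧ OpBound μ δ ∧
      Subsemigroup.closure μ.support = ⊤ := by
  have hTf : (insert 1 (S ∪ S⁻¹)).Finite := (hS.union hS.inv).insert 1
  set T : Finset Γ := hTf.toFinset with hT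
  have hmem : ∀ t, t ∈ T ↔ t = 1 ∨ t ∈ S ∨ t⁻¹ ∈ S := fun t => by simp [hT]
  have hinv : ∀ t ∈ T, t⁻¹ ∈ T := fun t ht => by
    rw [hmem] at ht ⊢
    simpa [or_comm] using ht
  have h1 : (1 : Γ) ∈ T := (hmem 1).2 (Or.inl rfl)
  have htop : ∀ U : Set Γ, (T : Set Γ) ⊆ U → Submonoid.closure U = ⊤ := fun U hU => by
    have h := Subgroup.closure_toSubmonoid S
    rw [hcl, Subgroup.top_toSubmonoid] at h
    rw [eq_top_iff, h]
    refine Submonoid.closure_mono fun t ht => hU ((hmem t).2 (Or.inr ?_))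
    simpa using ht
  obtain ⟨ρ, hρ, hop⟩ := exists_opBound_uniformOn hΓ hinv h1 (htop _ le_rfl)
  -- Powers of the averaging operator have norm at most `ρ ^ (N + 1)`; the shift keeps the exponent
  -- positive, so that the support contains `T`.
  have hlim := (ENNReal.tendsto_pow_atTop_nhds_zero_of_lt_one hρ).comp (tendsto_add_atTop_nat 1)
  obtain ⟨N, hN⟩ := (hlim.eventually (ge_mem_nhds (pos_iff_ne_zero.2 hδ))).exists
  have hsub : (T : Set Γ) ⊆ (iterConv (uniformOn T) (N + 1)).support := fun t ht =>
    iterConv_succ_ne_zero (uniformOn_ne_zero.2 h1) (uniformOn_ne_zero.2 ht) N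
  refine ⟨iterConv (uniformOn T) (N + 1), tsum_iterConv (tsum_uniformOn ⟨1, h1⟩) _,
    iterConv_inv (uniformOn_inv hinv) _, support_iterConv_finite ?_ _,
    (hop.iterConv _).mono le_rfl hN, ?_⟩
  · exact T.finite_toSet.subset fun g hg => uniformOn_ne_zero.1 hg
  · exact Subsemigroup.closure_eq_top_of_submonoid (hsub h1) (htop _ hsub)

end Base

/-! ### Word length: subadditivity, symmetry and properness. -/

section WordLength

variable {Γ : Type*} [Group Γ] {S : Set Γ}

lemma wordLength_le (w : List Γ) (hw : ∀ a ∈ w, a ∈ S ∨ a⁻¹ ∈ S) :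
    wordLength S w.prod ≤ w.length :=
  Nat.sInf_le ⟨w, rfl, hw, rfl⟩

lemma exists_word (hS : Subgroup.closure S = ⊤) (g : Γ) :
    ∃ w : List Γ, w.length = wordLength S g ∧ (∀ a ∈ w, a ∈ S ∨ a⁻¹ ∈ S) ∧ w.prod = g := by
  have hne : {n | ∃ w : List Γ, w.length = n ∧ (∀ a ∈ w, a ∈ S ∨ a⁻¹ ∈ S) ∧ w.prod = g}.Nonempty := by
    have hg : g ∈ (Subgroup.closure S).toSubmonoid := by simp [hS]
    rw [Subgroup.closure_toSubmonoid] at hg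
    obtain ⟨w, hw, hg⟩ := Submonoid.exists_list_of_mem_closure hg
    exact ⟨w.length, w, rfl, hw, hg⟩
  exact Nat.sInf_mem hne

lemma wordLength_one : wordLength S (1 : Γ) = 0 :=
  Nat.le_zero.1 (wordLength_le [] (by simp))

lemma wordLength_mul_le (hS : Subgroup.closure S = ⊤) (g h : Γ) :
    wordLength S (g * h) ≤ wordLength S g + wordLength S h := by
  obtain ⟨w, hw, hwS, rfl⟩ := exists_word hS g
  obtain ⟨v, hv, hvS, rfl⟩ := exists_word hS h
  rw [← hw, ← hv, ← List.prod_append, ← List.length_append]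
  refine wordLength_le _ fun a ha => ?_
  exact (List.mem_append.1 ha).elim (hwS a) (hvS a)

lemma wordLength_inv_le (hS : Subgroup.closure S = ⊤) (g : Γ) :
    wordLength S g⁻¹ ≤ wordLength S g := by
  obtain ⟨w, hw, hwS, rfl⟩ := exists_word hS g
  rw [← hw, List.prod_inv_reverse]
  refine (wordLength_le _ fun a ha => ?_).trans (by simp)
  simp only [List.mem_reverse, List.mem_map] at ha
  obtain ⟨b, hb, rfl⟩ := ha
  simpa [or_comm] using hwS b hb

lemma wordLength_inv (hS : Subgroup.closure S = ⊤) (g : Γ) :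
    wordLength S g⁻¹ = wordLength S g :=
  le_antisymm (wordLength_inv_le hS g) (by simpa using wordLength_inv_le hS g⁻¹)

lemma finite_setOf_wordLength_eq (hS : Subgroup.closure S = ⊤) (hf : S.Finite) (n : ℕ) :
    {g | wordLength S g = n}.Finite := by
  have hprod : ∀ w : List Γ, (∀ a ∈ w, a ∈ S ∨ a⁻¹ ∈ S) → w.prod ∈ (S ∪ S⁻¹) ^ w.length := by
    intro w
    induction w with
    | nil => simp
    | cons a w ih =>
      intro hw
      rw [List.prod_cons, List.length_cons, pow_succ']
      exact Set.mul_mem_mul (hw a (by simp)) (ih fun b hb => hw b (by simp [hb]))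
  have hpow : ((S ∪ S⁻¹) ^ n).Finite := by
    induction n with
    | zero => simp
    | succ n ih =>
      rw [pow_succ]
      exact ih.mul (hf.union hf.inv)
  refine hpow.subset ?_
  rintro g rfl
  obtain ⟨w, hw, hwS, hg⟩ := exists_word hS g
  have := hprod w hwS
  rwa [hw, hg] at this

lemma tendsto_wordLength (hS : Subgroup.closure S = ⊤) (hf : S.Finite) :
    Tendsto (wordLength S) cofinite atTop := by
  rw [← Nat.cofinite_eq_atTop]
  exact Tendsto.cofinite_of_finite_preimage_singleton fun n => finite_setOf_wordLength_eq hS hf n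

end WordLength

/-! ### Choice of sparse scales and decay rates. -/

section Scales

lemma ENNReal.tsum_ofReal_pow {x : ℝ} (h0 : 0 ≤ x) (h1 : x < 1) :
    ∑' n : ℕ, ENNReal.ofReal x ^ n = ENNReal.ofReal (1 - x)⁻¹ := by
  rw [ENNReal.tsum_geometric, ENNReal.ofReal_inv_of_pos (by linarith), ENNReal.ofReal_sub _ h0,
    ENNReal.ofReal_one]

lemma ENNReal.tsum_ofReal_pow_succ {x : ℝ} (h0 : 0 ≤ x) (h1 : x < 1) :
    ∑' n : ℕ, ENNReal.ofReal x ^ (n + 1) = ENNReal.ofReal (x * (1 - x)⁻¹) := by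
  simp only [pow_succ']
  rw [ENNReal.tsum_mul_left, ENNReal.tsum_ofReal_pow h0 h1, ENNReal.ofReal_mul h0]

lemma ENNReal.eventually_le_mul_pow {a : ℝ≥0∞} (ha : 1 < a) {C : ℝ≥0∞} (hC : C ≠ ∞) :
    ∀ᶠ m : ℕ in atTop, C ≤ a ^ m := by
  have h := ENNReal.tendsto_pow_atTop_nhds_zero_of_lt_one (ENNReal.inv_lt_one.2 ha)
  filter_upwards [h.eventually (ge_mem_nhds (pos_iff_ne_zero.2 (ENNReal.inv_ne_zero.2 hC)))] with m hm
  rwa [← ENNReal.inv_pow, ENNReal.inv_le_inv] at hm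

/-- Weights which are negligible for the rate `c (n + 1)` but not for the rate `c n`, along
a sparse sequence. -/
lemma exists_scales {ℓ : ℕ → ℕ} (hℓ : Tendsto ℓ atTop atTop) {P : ℕ → Prop}
    (hP : ∃ᶠ j in atTop, P j) (l : ℕ) {c : ℕ → ℝ≥0∞} (hc : StrictAnti c) (hc1 : ∀ n, 1 < c n)
    (hct : ∀ n, c n ≠ ∞) {δ : ℕ → ℝ≥0∞} (hδ : ∀ n, 0 < δ n) :
    ∃ (φ : ℕ → ℕ) (ε : ℕ → ℝ≥0∞), StrictMono φ ∧ (∀ n, P (φ n)) ∧ (∀ n, ε n ≠ 0) ∧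
      (∀ n, ε (n + 1) ≤ ε n * ENNReal.ofReal (1 / 64)) ∧
      (∀ n, 2 * ε n * c (n + 1) ^ (ℓ (φ n) + l) ≤ δ n) ∧
      ∀ n, 16 * c n ^ l ≤ ε n * c n ^ ℓ (φ n) := by
  have step : ∀ (n p : ℕ) (e : {e : ℝ≥0∞ // e ≠ 0}), ∃ (q : ℕ × {e : ℝ≥0∞ // e ≠ 0}),
      p < q.1 ∧ P q.1 ∧ (q.2 : ℝ≥0∞) ≤ e * ENNReal.ofReal (1 / 64) ∧
      2 * q.2 * c (n + 1) ^ (ℓ q.1 + l) ≤ δ n ∧ 16 * c n ^ l ≤ q.2 * c n ^ ℓ q.1 := by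
    intro n p e
    -- The mass is `b⁻¹ ^ ℓ`: since `c (n + 1) < b < c n`, it beats the rate `c (n + 1)` and loses
    -- to `c n` at all large lengths.
    obtain ⟨b, hb, hb'⟩ := exists_between (hc n.lt_succ_self)
    have hbt : b ≠ ∞ := hb'.ne_top
    have hb1 : 1 < b := (hc1 _).trans hb
    have hb0 : b ≠ 0 := (zero_lt_one.trans hb1).ne'
    have e1 : ∀ᶠ m : ℕ in atTop, b⁻¹ ^ m ≤ e * ENNReal.ofReal (1 / 64) :=
      (ENNReal.tendsto_pow_atTop_nhds_zero_of_lt_one (ENNReal.inv_lt_one.2 hb1)).eventually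
        (ge_mem_nhds (ENNReal.mul_pos e.2 (by simp)))
    have hlt : b⁻¹ * c (n + 1) < 1 := by
      rw [mul_comm, ← div_eq_mul_inv]
      exact ENNReal.div_lt_of_lt_mul (by simpa using hb)
    have e2 : ∀ᶠ m : ℕ in atTop, 2 * b⁻¹ ^ m * c (n + 1) ^ (m + l) ≤ δ n := by
      have h := ENNReal.Tendsto.const_mul (a := 2 * c (n + 1) ^ l)
        (ENNReal.tendsto_pow_atTop_nhds_zero_of_lt_one hlt)
        (Or.inr (ENNReal.mul_ne_top (by simp) (ENNReal.pow_ne_top (hct _))))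
      rw [mul_zero] at h
      filter_upwards [h.eventually (ge_mem_nhds (hδ n))] with m hm
      refine le_trans (le_of_eq ?_) hm
      rw [mul_pow, pow_add]
      ring
    have e3 : ∀ᶠ m : ℕ in atTop, 16 * c n ^ l ≤ b⁻¹ ^ m * c n ^ m := by
      have : 1 < b⁻¹ * c n := by
        rw [mul_comm, ← div_eq_mul_inv, ENNReal.lt_div_iff_mul_lt (Or.inl hb0) (Or.inl hbt), one_mul]
        exact hb'
      filter_upwards [ENNReal.eventually_le_mul_pow this
        (ENNReal.mul_ne_top (by simp) (ENNReal.pow_ne_top (hct n)) : 16 * c n ^ l ≠ ∞)] with m hm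
      rwa [mul_pow] at hm
    obtain ⟨j, hj, ⟨⟨h1, h2⟩, h3⟩, h4⟩ := (hP.and_eventually
      (((hℓ.eventually e1).and (hℓ.eventually e2)).and (hℓ.eventually e3) |>.and
        (eventually_gt_atTop p))).exists
    exact ⟨⟨j, b⁻¹ ^ ℓ j, pow_ne_zero _ (ENNReal.inv_ne_zero.2 hbt)⟩, h4, hj, h1, h2, h3⟩
  choose F h1 h2 h3 h4 h5 using step
  let s : ℕ → ℕ × {e : ℝ≥0∞ // e ≠ 0} := fun n =>
    Nat.rec (F 0 0 ⟨1, one_ne_zero⟩) (fun n q => F (n + 1) q.1 q.2) n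
  have hs : ∀ n, ∃ p e, s n = F n p e := fun n => by
    cases n with
    | zero => exact ⟨_, _, rfl⟩
    | succ n => exact ⟨_, _, rfl⟩
  refine ⟨fun n => (s n).1, fun n => (s n).2, strictMono_nat_of_lt_succ fun n => h1 _ _ _, fun n => ?_,
    fun n => (s n).2.2, fun n => h3 _ _ _, fun n => ?_, fun n => ?_⟩ <;>
  obtain ⟨p, e, hpe⟩ := hs n <;> simp only [hpe]
  exacts [h2 _ _ _, h4 _ _ _, h5 _ _ _]

/-- A decreasing sequence of rates, bounded away from `1`, with `c 0 ^ R ≤ 2`. -/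
lemma exists_rates (R : ℕ) : ∃ (a : ℝ≥0∞) (c : ℕ → ℝ≥0∞), 1 < a ∧ StrictAnti c ∧ (∀ n, a < c n) ∧
    (∀ n, c n ≠ ∞) ∧ ∀ n, c n ^ R ≤ 2 := by
  have hR : (0 : ℝ) < ((R : ℝ) + 1)⁻¹ := by positivity
  -- All rates are taken below the `(R + 1)`-th root of `2`; the shift covers `R = 0`.
  have h2 : (1 : ℝ≥0∞) < 2 ^ ((R : ℝ) + 1)⁻¹ := ENNReal.one_lt_rpow (by norm_num) hR
  obtain ⟨a, ha1, ha2⟩ := exists_between h2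
  obtain ⟨c, hc, hmem, -⟩ := exists_seq_strictAnti_tendsto' ha2
  refine ⟨a, c, ha1, hc, fun n => (hmem n).1, fun n => (hmem n).2.ne_top, fun n => ?_⟩
  calc c n ^ R ≤ c n ^ (R + 1) := pow_le_pow_right₀ (ha1.trans (hmem n).1).le R.le_succ
    _ ≤ (2 ^ ((R : ℝ) + 1)⁻¹) ^ (R + 1) := by gcongr; exact (hmem n).2.le
    _ = 2 := by
      rw [← ENNReal.rpow_natCast, ← ENNReal.rpow_mul]
      push_cast
      rw [inv_mul_cancel₀ (by positivity), ENNReal.rpow_one]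

end Scales

/-! ### Adding sparse symmetric atoms to the base measure. -/

section Perturbation

variable {Γ : Type*} [Group Γ]

open Classical in
/-- Symmetric atoms of mass `e` at `w` and `w⁻¹`. -/
noncomputable def symmAtoms (e : ℝ≥0∞) (w g : Γ) : ℝ≥0∞ :=
  e * ((if g = w then 1 else 0) + (if g = w⁻¹ then 1 else 0))

lemma tsum_symmAtoms_mul (e : ℝ≥0∞) (w : Γ) (ω : Γ → ℝ≥0∞) :
    ∑' g, symmAtoms e w g * ω g = e * (ω w + ω w⁻¹) := by
  classical
  simp only [symmAtoms, mul_assoc, ENNReal.tsum_mul_left, add_mul, ENNReal.tsum_add, ite_mul,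
    one_mul, zero_mul]
  rw [tsum_ite_eq, tsum_ite_eq]

lemma tsum_symmAtoms (e : ℝ≥0∞) (w : Γ) : ∑' g, symmAtoms e w g = 2 * e := by
  have := tsum_symmAtoms_mul e w fun _ => 1
  simp only [mul_one] at this
  rw [this]
  ring

lemma symmAtoms_inv (e : ℝ≥0∞) (w g : Γ) : symmAtoms e w g⁻¹ = symmAtoms e w g := by
  classical
  rw [symmAtoms, symmAtoms, add_comm]
  exact congrArg (e * ·) (congrArg₂ (· + ·) (if_congr inv_inj rfl rfl)
    (if_congr inv_eq_iff_eq_inv rfl rfl))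

lemma le_symmAtoms (e : ℝ≥0∞) (w : Γ) : e ≤ symmAtoms e w w := by
  simp only [symmAtoms, if_true]
  exact le_mul_of_one_le_right' le_self_add

lemma symmAtoms_eq_zero {e : ℝ≥0∞} {w g : Γ} (h : g ≠ w) (h' : g ≠ w⁻¹) : symmAtoms e w g = 0 := by
  simp [symmAtoms, h, h']

/-- Data of a base measure `μ` with small norm and of sparse symmetric atoms of mass `ε n` at `w n`,
at distance about `m n`, which are negligible for the exponential rate `c (n + 1)` but not for
the rate `c n`. -/
structure PerturbationData (ℓ : Γ → ℕ) (l : ℕ) (μ : Γ → ℝ≥0∞) (c : ℕ → ℝ≥0∞) (ε : ℕ → ℝ≥0∞)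
    (w : ℕ → Γ) (m : ℕ → ℕ) : Prop where
  len_one : ℓ 1 = 0
  len_mul : ∀ g h, ℓ (g * h) ≤ ℓ g + ℓ h
  len_inv : ∀ g, ℓ g⁻¹ = ℓ g
  opBound : OpBound μ (ENNReal.ofReal (1 / 128))
  one_lt_rate : ∀ n, 1 < c n
  rate_ne_top : ∀ n, c n ≠ ∞
  antitone_rate : Antitone c
  weighted_le : ∀ n g, μ g * c n ^ ℓ g ≤ 2 * μ g
  mass_ne_zero : ∀ n, ε n ≠ 0
  mass_succ_le : ∀ n, ε (n + 1) ≤ ε n * ENNReal.ofReal (1 / 64)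
  tsum_weighted_le : ∑' n, 2 * ε n * c (n + 1) ^ (m n + l) ≤ ENNReal.ofReal (1 / 64)
  le_mass_mul : ∀ n, 16 * c n ^ l ≤ ε n * c n ^ m n
  len_le : ∀ n, ℓ (w n) ≤ m n + l

namespace PerturbationData

variable {ℓ : Γ → ℕ} {l : ℕ} {μ : Γ → ℝ≥0∞} {c : ℕ → ℝ≥0∞} {ε : ℕ → ℝ≥0∞} {w : ℕ → Γ} {m : ℕ → ℕ}

lemma tsum_mass_le (h : PerturbationData ℓ l μ c ε w m) :
    ∑' n, 2 * ε n ≤ ENNReal.ofReal (1 / 64) :=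
  le_trans (ENNReal.tsum_le_tsum fun _ =>
    le_mul_of_one_le_right' (one_le_pow₀ (h.one_lt_rate _).le)) h.tsum_weighted_le

lemma mass_ne_top (h : PerturbationData ℓ l μ c ε w m) (n : ℕ) : ε n ≠ ∞ := fun hn => by
  have := (ENNReal.le_tsum n).trans h.tsum_mass_le
  rw [hn, ENNReal.mul_top two_ne_zero, top_le_iff] at this
  exact ENNReal.ofReal_ne_top this

lemma tsum_mass_add_le (h : PerturbationData ℓ l μ c ε w m) (n : ℕ) :
    ∑' k, 2 * ε (n + k) ≤ ε n * ENNReal.ofReal 3 := by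
  have hk : ∀ k, ε (n + k) ≤ ε n * ENNReal.ofReal (1 / 64) ^ k := fun k => by
    induction k with
    | zero => simp
    | succ k ih =>
      calc ε (n + k + 1) ≤ ε (n + k) * ENNReal.ofReal (1 / 64) := h.mass_succ_le _
        _ ≤ ε n * ENNReal.ofReal (1 / 64) ^ k * ENNReal.ofReal (1 / 64) := by gcongr
        _ = _ := by rw [pow_succ, mul_assoc]
  calc ∑' k, 2 * ε (n + k) ≤ ∑' k, 2 * (ε n * ENNReal.ofReal (1 / 64) ^ k) :=
        ENNReal.tsum_le_tsum fun k => mul_le_mul_right (hk k) _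
    _ = ε n * (ENNReal.ofReal 2 * ENNReal.ofReal (1 - 1 / 64)⁻¹) := by
        rw [ENNReal.tsum_mul_left, ENNReal.tsum_mul_left,
          ENNReal.tsum_ofReal_pow (by norm_num) (by norm_num), ENNReal.ofReal_ofNat]
        ring
    _ ≤ ε n * ENNReal.ofReal 3 := by
        rw [← ENNReal.ofReal_mul (by norm_num)]
        gcongr
        norm_num

lemma tsum_tail_le (h : PerturbationData ℓ l μ c ε w m) (n : ℕ) :
    ∑' g, ∑' k, symmAtoms (ε (n + k)) (w (n + k)) g ≤ ε n * ENNReal.ofReal 3 := by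
  rw [ENNReal.tsum_comm]
  simp only [tsum_symmAtoms]
  exact h.tsum_mass_add_le n

lemma tsum_atoms_weight_le (h : PerturbationData ℓ l μ c ε w m) {n : ℕ} {a : ℝ≥0∞}
    (ha : a ≤ c (n + 1)) :
    ∑' g, symmAtoms (ε n) (w n) g * a ^ ℓ g ≤ 2 * ε n * c (n + 1) ^ (m n + l) := by
  rw [tsum_symmAtoms_mul, h.len_inv]
  calc ε n * (a ^ ℓ (w n) + a ^ ℓ (w n)) = 2 * ε n * a ^ ℓ (w n) := by ring
    _ ≤ 2 * ε n * c (n + 1) ^ ℓ (w n) := by gcongr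
    _ ≤ _ := by
      gcongr
      · exact (h.one_lt_rate _).le
      · exact h.len_le n

/-- The measure with all atoms. -/
lemma opBound_total (h : PerturbationData ℓ l μ c ε w m) :
    OpBound (μ + fun g => ∑' k, symmAtoms (ε k) (w k) g) (ENNReal.ofReal (1 / 32)) := by
  have hJ : OpBound (fun g => ∑' k, symmAtoms (ε k) (w k) g) (ENNReal.ofReal (1 / 64)) := by
    refine opBound_of_tsum_le ?_
    rw [ENNReal.tsum_comm]
    simp only [tsum_symmAtoms]
    exact h.tsum_mass_le
  refine (h.opBound.add hJ (by simp) (by simp) (by simp) (by simp)).mono le_rfl ?_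
  rw [← ENNReal.ofReal_add (by norm_num) (by norm_num)]
  exact ENNReal.ofReal_le_ofReal (by norm_num)

/-- The measure with the first `n` atoms decays at rate `c n`. -/
lemma opBound_weighted (h : PerturbationData ℓ l μ c ε w m) (n : ℕ) :
    OpBound (fun g => (μ + fun g => ∑ k ∈ Finset.range n, symmAtoms (ε k) (w k) g) g * c n ^ ℓ g)
      (ENNReal.ofReal (1 / 32)) := by
  have hJ : OpBound (fun g => ∑ k ∈ Finset.range n, symmAtoms (ε k) (w k) g * c n ^ ℓ g)
      (ENNReal.ofReal (1 / 64)) := by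
    refine opBound_of_tsum_le ?_
    rw [Summable.tsum_finsetSum fun _ _ => ENNReal.summable]
    refine le_trans (Finset.sum_le_sum fun k hk => h.tsum_atoms_weight_le (h.antitone_rate ?_))
      ((ENNReal.sum_le_tsum _).trans h.tsum_weighted_le)
    exact Finset.mem_range.1 hk
  refine ((h.opBound.const_mul 2).add hJ (by simp) (by finiteness) (by simp) (by simp)).mono
    (fun g => ?_) ?_
  · simp only [Pi.add_apply, add_mul, Finset.sum_mul]
    exact add_le_add (h.weighted_le n g) le_rfl
  · rw [← ENNReal.ofReal_ofNat, ← ENNReal.ofReal_mul (by norm_num),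
      ← ENNReal.ofReal_add (by norm_num) (by norm_num)]
    exact ENNReal.ofReal_le_ofReal (by norm_num)

/-- The Green function at scale `n`, away from the atoms of index `n`, is at most half of their mass. -/
lemma tsum_iterConv_le (h : PerturbationData ℓ l μ c ε w m) {n : ℕ} {g : Γ} (hg : g ≠ w n)
    (hg' : g ≠ (w n)⁻¹) (hm : m n ≤ ℓ g + l) :
    ∑' j, iterConv (μ + fun g => ∑' k, symmAtoms (ε k) (w k) g) j g ≤
      ε n * ENNReal.ofReal (1 / 2) := by
  set A : Γ → ℝ≥0∞ := μ + fun g => ∑ k ∈ Finset.range n, symmAtoms (ε k) (w k) g with hA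
  set R : Γ → ℝ≥0∞ := fun g => ∑' k, symmAtoms (ε (n + k)) (w (n + k)) g with hR
  have hsplit : (μ + fun g => ∑' k, symmAtoms (ε k) (w k) g) = A + R := by
    funext x
    simp only [hA, hR, Pi.add_apply, add_assoc]
    congr 1
    rw [← Summable.sum_add_tsum_nat_add' (k := n) ENNReal.summable]
    simp only [add_comm]
  -- Trajectories avoiding the atoms of index at least `n`: the weight `c n ^ ℓ` is
  -- submultiplicative, and the weighted measure still has norm at most `1/32`.
  have h1 : ∑' j, iterConv A j g ≤ ε n * ENNReal.ofReal (1 / 8) := by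
    have hpos : c n ^ m n ≠ 0 := pow_ne_zero _ (zero_lt_one.trans (h.one_lt_rate n)).ne'
    have hfin : c n ^ m n ≠ ∞ := ENNReal.pow_ne_top (h.rate_ne_top n)
    refine (ENNReal.mul_le_mul_iff_left hpos hfin).1 ?_
    have hw : (∑' j, iterConv A j g) * c n ^ ℓ g ≤ 2 := by
      rw [← ENNReal.tsum_mul_right]
      calc ∑' j, iterConv A j g * c n ^ ℓ g
          ≤ ∑' j : ℕ, ENNReal.ofReal (1 / 32) ^ j := ENNReal.tsum_le_tsum fun j =>
            (iterConv_mul_le (ω := fun g => c n ^ ℓ g) (by simp [h.len_one])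
              (fun g g' => (pow_le_pow_right₀ (h.one_lt_rate n).le (h.len_mul g g')).trans_eq
                (pow_add _ _ _)) A j g).trans ((h.opBound_weighted n).iterConv_le j g)
        _ ≤ 2 := by
          rw [ENNReal.tsum_ofReal_pow (by norm_num) (by norm_num), ← ENNReal.ofReal_ofNat]
          exact ENNReal.ofReal_le_ofReal (by norm_num)
    calc (∑' j, iterConv A j g) * c n ^ m n ≤ (∑' j, iterConv A j g) * c n ^ (ℓ g + l) := by
          gcongr
          exact (h.one_lt_rate n).le
      _ = (∑' j, iterConv A j g) * c n ^ ℓ g * c n ^ l := by rw [pow_add, mul_assoc]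
      _ ≤ 2 * c n ^ l := by gcongr
      _ = ENNReal.ofReal (1 / 8) * (16 * c n ^ l) := by
          rw [← mul_assoc, ← ENNReal.ofReal_ofNat 16, ← ENNReal.ofReal_mul (by norm_num),
            ← ENNReal.ofReal_ofNat 2]
          norm_num
      _ ≤ ENNReal.ofReal (1 / 8) * (ε n * c n ^ m n) := mul_le_mul_right (h.le_mass_mul n) _
      _ = _ := by ring
  -- A lone jump: the atoms of index `n` miss `g`, leaving only the tail from `n + 1`.
  have h2 : R g ≤ ε n * ENNReal.ofReal (3 / 64) := by
    have hz : R g = ∑' k, symmAtoms (ε (n + 1 + k)) (w (n + 1 + k)) g := by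
      rw [hR]
      simp only
      rw [tsum_eq_zero_add' ENNReal.summable, add_zero, symmAtoms_eq_zero hg hg', zero_add]
      simp only [add_assoc, add_comm 1]
    calc R g ≤ ∑' g, ∑' k, symmAtoms (ε (n + 1 + k)) (w (n + 1 + k)) g :=
          hz.trans_le (ENNReal.le_tsum (f := fun g => ∑' k, symmAtoms (ε (n + 1 + k)) (w (n + 1 + k)) g) g)
      _ ≤ ε (n + 1) * ENNReal.ofReal 3 := h.tsum_tail_le (n + 1)
      _ ≤ ε n * ENNReal.ofReal (1 / 64) * ENNReal.ofReal 3 := by gcongr; exact h.mass_succ_le n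
      _ = _ := by
          rw [mul_assoc, ← ENNReal.ofReal_mul (by norm_num)]
          norm_num
  have hs0 : ε n * ENNReal.ofReal 3 ≠ 0 := mul_ne_zero (h.mass_ne_zero n) (by simp)
  have hst : ε n * ENNReal.ofReal 3 ≠ ∞ := ENNReal.mul_ne_top (h.mass_ne_top n) (by simp)
  have hG := tsum_iterConv_add_le (hsplit ▸ h.opBound_total) (opBound_of_tsum_le (h.tsum_tail_le n))
    (by simp) (by simp) hs0 hst g
  have h3 : ∑' j : ℕ, (2 * ENNReal.ofReal (1 / 32)) ^ (j + 1) = ENNReal.ofReal (1 / 15) := by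
    rw [← ENNReal.ofReal_ofNat, ← ENNReal.ofReal_mul (by norm_num),
      ENNReal.tsum_ofReal_pow_succ (by norm_num) (by norm_num)]
    norm_num
  rw [h3] at hG
  rw [hsplit]
  -- The three terms are no late atom, one lone late jump, and late jumps in at least two steps.
  calc _ ≤ ε n * ENNReal.ofReal (1 / 8) + ε n * ENNReal.ofReal (3 / 64) +
        ε n * ENNReal.ofReal 3 * ENNReal.ofReal (1 / 15) := hG.trans (by gcongr)
    _ = ε n * ENNReal.ofReal (1 / 8 + 3 / 64 + 3 * (1 / 15)) := by
        rw [mul_assoc, ← ENNReal.ofReal_mul (by norm_num), ← mul_add, ← mul_add,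
          ← ENNReal.ofReal_add (by norm_num) (by norm_num),
          ← ENNReal.ofReal_add (by norm_num) (by norm_num)]
    _ ≤ _ := by
        gcongr
        norm_num

end PerturbationData

end Perturbation

/-! ### Positivity of convolution powers. -/

section Positivity

variable {Γ : Type*} [Group Γ]

lemma iterConv_add_index (ν : Γ → ℝ≥0∞) (m n : ℕ) :
    iterConv ν (m + n) = convolve (iterConv ν m) (iterConv ν n) := by
  induction n with
  | zero => rw [convolve_zero_right_iter, add_zero]
  | succ n ih => rw [← add_assoc, iterConv, ih, convolve_assoc, iterConv]

lemma exists_iterConv_ne_zero {ν : Γ → ℝ≥0∞} (hν : Subsemigroup.closure ν.support = ⊤) (g : Γ) :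
    ∃ n, iterConv ν n g ≠ 0 := by
  have : g ∈ Subsemigroup.closure ν.support := hν ▸ Subsemigroup.mem_top g
  induction this using Subsemigroup.closure_induction with
  | mem g hg => exact ⟨1, by rwa [iterConv_one]⟩
  | mul a b _ _ ha hb =>
    obtain ⟨m, hm⟩ := ha
    obtain ⟨n, hn⟩ := hb
    refine ⟨m + n, fun h => ?_⟩
    rw [iterConv_add_index] at h
    have := ENNReal.tsum_eq_zero.1 h a
    rw [inv_mul_cancel_left] at this
    exact mul_ne_zero hm hn this

end Positivity

/-! ### Green function and exponential tails of a probability. -/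

namespace PMF

variable {Γ : Type*} [Group Γ]

lemma green_eq (μ : PMF Γ) (x z : Γ) : μ.green x z = ∑' n, iterConv μ n (x⁻¹ * z) := by
  simp only [green, convPow_eq_iterConv]

lemma IsAdmissible.green_ne_zero {μ : PMF Γ} (h : μ.IsAdmissible) (x z : Γ) : μ.green x z ≠ 0 := by
  obtain ⟨n, hn⟩ := exists_iterConv_ne_zero (ν := μ) h (x⁻¹ * z)
  rw [green_eq]
  exact fun h => hn (ENNReal.tsum_eq_zero.1 h n)

lemma apply_le_green (μ : PMF Γ) (x z : Γ) : μ (x⁻¹ * z) ≤ μ.green x z := by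
  rw [green_eq]
  have := ENNReal.le_tsum (f := fun n => iterConv μ n (x⁻¹ * z)) 1
  rwa [iterConv_one] at this

/-- Markov's inequality at rate `a`; passing to a smaller rate `b > 1` absorbs the constant for
large `n`. -/
lemma hasExponentialTails_of_tsum_ne_top {μ : PMF Γ} {S : Set Γ} (hf : S.Finite)
    (hS : Subgroup.closure S = ⊤) {a : ℝ≥0∞} (ha : 1 < a)
    (h : ∑' g, μ g * a ^ wordLength S g ≠ ∞) : μ.HasExponentialTails := by
  classical
  obtain ⟨b, hb1, hb⟩ := exists_between ha
  have hbt : b ≠ ∞ := hb.ne_top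
  have hb0 : b ≠ 0 := (zero_lt_one.trans hb1).ne'
  refine ⟨S, hf, hS, b.toReal, by simpa using (ENNReal.toReal_lt_toReal ENNReal.one_ne_top hbt).2 hb1, ?_⟩
  set K := ∑' g, μ g * a ^ wordLength S g
  have hK1 : K + 1 ≠ ∞ := ENNReal.add_ne_top.2 ⟨h, ENNReal.one_ne_top⟩
  have hab : 1 < a * b⁻¹ := by
    rw [← div_eq_mul_inv, ENNReal.lt_div_iff_mul_lt (Or.inl hb0) (Or.inl hbt), one_mul]
    exact hb
  filter_upwards [ENNReal.eventually_le_mul_pow hab hK1] with n hn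
  rw [ENNReal.ofReal_inv_of_pos (pow_pos (ENNReal.toReal_pos hb0 hbt) n),
    ENNReal.ofReal_pow ENNReal.toReal_nonneg, ENNReal.ofReal_toReal hbt]
  set P := μ.toOuterMeasure {g | n < wordLength S g} with hP
  have hPa : P * a ^ n ≤ K := by
    rw [hP, toOuterMeasure_apply, ← ENNReal.tsum_mul_right]
    refine ENNReal.tsum_le_tsum fun g => ?_
    by_cases hg : g ∈ {g | n < wordLength S g}
    · rw [Set.indicator_of_mem hg]
      exact mul_le_mul_right (pow_le_pow_right₀ ha.le (le_of_lt hg)) _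
    · simp [Set.indicator_of_notMem hg]
  have hPb : (K + 1) * (P * b ^ n) ≤ (K + 1) * 1 := by
    calc (K + 1) * (P * b ^ n) ≤ (a * b⁻¹) ^ n * (P * b ^ n) := by gcongr
      _ = P * a ^ n * (b⁻¹ * b) ^ n := by rw [mul_pow, mul_pow]; ring
      _ = P * a ^ n := by rw [ENNReal.inv_mul_cancel hb0 hbt, one_pow, mul_one]
      _ ≤ (K + 1) * 1 := by rw [mul_one]; exact hPa.trans le_self_add
  have hPb' := (ENNReal.mul_le_mul_iff_right (by simp) hK1).1 hPb
  rwa [← ENNReal.le_div_iff_mul_le (Or.inl (pow_ne_zero n hb0)) (Or.inl (ENNReal.pow_ne_top hbt)),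
    one_div] at hPb'

end PMF

/-! ### Normalization to a probability. -/

namespace PerturbationData

variable {Γ : Type*} [Group Γ] {ℓ : Γ → ℕ} {l : ℕ} {μ : Γ → ℝ≥0∞} {c : ℕ → ℝ≥0∞} {ε : ℕ → ℝ≥0∞}
  {w : ℕ → Γ} {m : ℕ → ℕ}

/-- Normalization of the base measure with its atoms to a probability. -/
lemma exists_pmf (h : PerturbationData ℓ l μ c ε w m) (hμ : ∑' g, μ g = 1)
    (hsymm : ∀ g, μ g⁻¹ = μ g) (hcl : Subsemigroup.closure μ.support = ⊤) {a : ℝ≥0∞}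
    (ha : ∀ n, a ≤ c n) :
    ∃ p : PMF Γ, p.IsAdmissible ∧ p.IsSymmetric ∧ ∑' g, p g * a ^ ℓ g ≠ ∞ ∧
      (p : Γ → ℝ≥0∞) ≤ (μ + fun g => ∑' k, symmAtoms (ε k) (w k) g) ∧ ∀ k, ε k ≤ p (w k) := by
  set t := ∑' k, 2 * ε k with ht
  have ht1 : t < 1 := h.tsum_mass_le.trans_lt (by simp)
  have hsum : ∑' g, ((1 - t) * μ g + ∑' k, symmAtoms (ε k) (w k) g) = 1 := by
    rw [ENNReal.tsum_add, ENNReal.tsum_mul_left, hμ, ENNReal.tsum_comm]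
    simp only [tsum_symmAtoms]
    rw [mul_one, ← ht, tsub_add_cancel_of_le ht1.le]
  -- Only the base is rescaled: the atoms keep their full mass for the lower bound, and domination
  -- by the unnormalized measure suffices for upper bounds.
  let p : PMF Γ := ⟨fun g => (1 - t) * μ g + ∑' k, symmAtoms (ε k) (w k) g,
    (ENNReal.summable.hasSum_iff).2 hsum⟩
  have hp : ∀ g, p g = (1 - t) * μ g + ∑' k, symmAtoms (ε k) (w k) g := fun g => rfl
  have hle : (p : Γ → ℝ≥0∞) ≤ (μ + fun g => ∑' k, symmAtoms (ε k) (w k) g) := fun g => by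
    rw [hp]
    exact add_le_add (mul_le_of_le_one_left' tsub_le_self) le_rfl
  refine ⟨p, ?_, fun g => ?_, ?_, hle, fun k => ?_⟩
  · refine eq_top_iff.2 (hcl.symm.le.trans (Subsemigroup.closure_mono fun g hg => ?_))
    rw [PMF.mem_support_iff, hp]
    exact fun h0 => mul_ne_zero (tsub_pos_of_lt ht1).ne' hg (add_eq_zero.1 h0).1
  · simp only [hp, hsymm, symmAtoms_inv]
  · have h1 : ∑' g, p g * a ^ ℓ g ≤ 2 + ENNReal.ofReal (1 / 64) :=
      calc ∑' g, p g * a ^ ℓ g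
          ≤ ∑' g, (μ g * c 0 ^ ℓ g + ∑' k, symmAtoms (ε k) (w k) g * a ^ ℓ g) :=
            ENNReal.tsum_le_tsum fun g => by
              refine (mul_le_mul_left (hle g) _).trans ?_
              rw [Pi.add_apply, add_mul, ENNReal.tsum_mul_right]
              gcongr
              exact ha 0
        _ ≤ 2 + ENNReal.ofReal (1 / 64) := by
            rw [ENNReal.tsum_add, ENNReal.tsum_comm]
            refine add_le_add ?_ (le_trans (ENNReal.tsum_le_tsum fun k =>
              h.tsum_atoms_weight_le (ha _)) h.tsum_weighted_le)
            refine (ENNReal.tsum_le_tsum (h.weighted_le 0)).trans_eq ?_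
            rw [ENNReal.tsum_mul_left, hμ, mul_one]
    exact ne_top_of_le_ne_top (by simp) h1
  · rw [hp]
    exact (le_symmAtoms _ _).trans
      ((ENNReal.le_tsum (f := fun j => symmAtoms (ε j) (w j) (w k)) k).trans le_add_self)

end PerturbationData

/-! ### Oscillation of the Martin kernel. -/

theorem theorem1p1 (Γ : Type*) [Group Γ] [Group.FG Γ] (hΓ : ¬ IsAmenable Γ)
    (y : ℕ → Γ) (hy : Tendsto y atTop cofinite) :
    ∃ μ : PMF Γ, μ.IsAdmissible ∧ μ.IsSymmetric ∧ μ.HasExponentialTails ∧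
      (∀ x z : Γ, μ.green x z ≠ ∞) ∧
      ¬ μ.ConvergesInMartinBoundary y := by
  classical
  obtain ⟨S, hS, hSf⟩ := Group.fg_iff.1 ‹Group.FG Γ›
  let ℓ : Γ → ℕ := wordLength S
  have hinf : Infinite Γ := by
    by_contra hfin
    rw [not_infinite_iff_finite] at hfin
    have := hy.eventually_mem (f := y) (s := ∅) (by simp)
    simpa using this.exists
  -- Symmetry also puts an atom at `(w k)⁻¹`. It would spoil the comparison exactly when `y j * y j
  -- = z`, which one of two candidates for `z` avoids infinitely often.
  obtain ⟨z, hz1, hz⟩ : ∃ z : Γ, z ≠ 1 ∧ ∃ᶠ j in atTop, y j * y j ≠ z := by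
    obtain ⟨z₁, h₁⟩ := Infinite.exists_notMem_finset ({1} : Finset Γ)
    obtain ⟨z₂, h₂⟩ := Infinite.exists_notMem_finset ({1, z₁} : Finset Γ)
    simp only [Finset.mem_singleton, Finset.mem_insert, not_or] at h₁ h₂
    have : ∃ᶠ j in atTop, (y j * y j ≠ z₁ ∨ y j * y j ≠ z₂) :=
      Eventually.frequently (Eventually.of_forall fun j => by
        by_contra! hj
        exact h₂.2 (hj.2.symm.trans hj.1))
    rcases frequently_or_distrib.1 this with h | h
    exacts [⟨z₁, h₁, h⟩, ⟨z₂, h₂.1, h⟩]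
  -- Weighting at most doubles `1/128`; with atoms of weighted mass at most `1/64`, the norm stays
  -- at most `1/32`.
  obtain ⟨μ₀, hμ₀, hsymm, hfin, hop, hcl⟩ := exists_opBound_of_not_isAmenable hΓ hSf hS
    (δ := ENNReal.ofReal (1 / 128)) (by simp)
  obtain ⟨R, hR⟩ := (hfin.image ℓ).bddAbove
  obtain ⟨a, c, ha, hc, hac, hct, hcR⟩ := exists_rates R
  obtain ⟨δ, hδ, hδsum⟩ := ENNReal.exists_pos_sum_of_countable'
    (ε := ENNReal.ofReal (1 / 64)) (by simp) ℕ
  have hc1 : ∀ n, 1 < c n := fun n => ha.trans (hac n)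
  obtain ⟨φ, ε, hφ, hyz, hε0, hε, hεδ, hεc⟩ := exists_scales
    ((tendsto_wordLength hS hSf).comp hy) hz (ℓ z) hc hc1 hct hδ
  let w : ℕ → Γ := fun k => if Even k then y (φ k) else z⁻¹ * y (φ k)
  have hw_even : ∀ k, Even k → w k = y (φ k) := fun k hk => if_pos hk
  have hw_odd : ∀ k, ¬ Even k → w k = z⁻¹ * y (φ k) := fun k hk => if_neg hk
  have hlen_z : ∀ g, ℓ (z⁻¹ * g) ≤ ℓ g + ℓ z := fun g => by
    have := wordLength_mul_le hS z⁻¹ g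
    rw [wordLength_inv hS, add_comm] at this
    exact this
  have hlen_z' : ∀ g, ℓ g ≤ ℓ (z⁻¹ * g) + ℓ z := fun g => by
    have := wordLength_mul_le hS z (z⁻¹ * g)
    rw [mul_inv_cancel_left, add_comm] at this
    exact this
  have hdata : PerturbationData ℓ (ℓ z) μ₀ c ε w (fun k => ℓ (y (φ k))) :=
    { len_one := wordLength_one
      len_mul := wordLength_mul_le hS
      len_inv := wordLength_inv hS
      opBound := hop
      one_lt_rate := hc1
      rate_ne_top := hct
      antitone_rate := hc.antitone
      weighted_le := fun n g => by
        by_cases hg : μ₀ g = 0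
        · simp [hg]
        · rw [mul_comm]
          gcongr
          exact (pow_le_pow_right₀ (hc1 n).le (hR ⟨g, hg, rfl⟩)).trans (hcR n)
      mass_ne_zero := hε0
      mass_succ_le := hε
      tsum_weighted_le := (ENNReal.tsum_le_tsum hεδ).trans hδsum.le
      le_mass_mul := hεc
      len_le := fun n => by
        by_cases hn : Even n
        · rw [hw_even n hn]
          exact Nat.le_add_right _ _
        · rw [hw_odd n hn]
          exact hlen_z _ }
  obtain ⟨μ, hadm, hμsymm, hmom, hle, hεμ⟩ :=
    hdata.exists_pmf hμ₀ hsymm hcl fun n => (hac n).le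
  have hfinite : ∀ x x' : Γ, μ.green x x' ≠ ∞ := fun x x' => by
    rw [PMF.green_eq]
    refine ne_top_of_le_ne_top ?_ (ENNReal.tsum_le_tsum fun n =>
      (iterConv_mono hle n _).trans (hdata.opBound_total.iterConv_le n _))
    rw [ENNReal.tsum_ofReal_pow (by norm_num) (by norm_num)]
    exact ENNReal.ofReal_ne_top
  have hsmall : ∀ k x, x⁻¹ * y (φ k) ≠ w k → x⁻¹ * y (φ k) ≠ (w k)⁻¹ →
      ℓ (y (φ k)) ≤ ℓ (x⁻¹ * y (φ k)) + ℓ z →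
      μ.green x (y (φ k)) ≤ ε k * ENNReal.ofReal (1 / 2) := fun k x h1 h2 h3 => by
    rw [PMF.green_eq]
    exact (ENNReal.tsum_le_tsum fun n => iterConv_mono hle n _).trans
      (hdata.tsum_iterConv_le h1 h2 h3)
  have hlarge : ∀ k x, x⁻¹ * y (φ k) = w k → ε k ≤ μ.green x (y (φ k)) := fun k x h =>
    (hεμ k).trans (h ▸ μ.apply_le_green x (y (φ k)))
  have hratio : ∀ k x x', μ.green x (y (φ k)) ≤ ε k * ENNReal.ofReal (1 / 2) →
      ε k ≤ μ.green x' (y (φ k)) →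
      (μ.green x (y (φ k))).toReal ≤ 1 / 2 * (μ.green x' (y (φ k))).toReal := fun k x x' h h' => by
    have := ENNReal.toReal_mono (ENNReal.mul_ne_top (hfinite _ _) ENNReal.ofReal_ne_top)
      (h.trans (mul_le_mul_left h' _))
    rw [ENNReal.toReal_mul, ENNReal.toReal_ofReal (by norm_num)] at this
    linarith
  have hpos : ∀ x x', 0 < (μ.green x x').toReal := fun x x' =>
    ENNReal.toReal_pos (hadm.green_ne_zero x x') (hfinite x x')
  refine ⟨μ, hadm, hμsymm, PMF.hasExponentialTails_of_tsum_ne_top hSf hS ha hmom, hfinite, fun hconv => ?_⟩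
  obtain ⟨L, hL⟩ := hconv z
  have hLφ := hL.comp hφ.tendsto_atTop
  have heven : ∀ k, Even k → μ.martinKernel (y (φ k)) z ≤ 1 / 2 := fun k hk => by
    rw [PMF.martinKernel, div_le_iff₀ (hpos _ _)]
    -- Seen from `1`, the point `y (φ k)` is one atom jump away; seen from `z`, it is not. For odd
    -- `k` the roles are exchanged.
    refine hratio k z 1 (hsmall k z ?_ ?_ (hlen_z' _)) (hlarge k 1 (by simp [hw_even k hk]))
    · rw [hw_even k hk]
      simpa using hz1
    · rw [hw_even k hk]
      intro h
      exact hyz k (eq_mul_inv_iff_mul_eq.1 (inv_mul_eq_iff_eq_mul.1 h))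
  have hodd : ∀ k, ¬ Even k → 2 ≤ μ.martinKernel (y (φ k)) z := fun k hk => by
    rw [PMF.martinKernel, le_div_iff₀ (hpos _ _)]
    have := hratio k 1 z (hsmall k 1 ?_ ?_ (by simp)) (hlarge k z (hw_odd k hk).symm)
    · linarith
    · rw [hw_odd k hk]
      simpa using hz1
    · rw [hw_odd k hk]
      intro h
      rw [inv_one, one_mul, mul_inv_rev, inv_inv] at h
      exact hyz k (eq_inv_mul_iff_mul_eq.1 h)
  have h1 : L ≤ 1 / 2 := le_of_tendsto_of_frequently hLφ
    (frequently_atTop.2 fun n => ⟨2 * n, by omega, heven _ (even_two_mul n)⟩)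
  have h2 : 2 ≤ L := ge_of_tendsto_of_frequently hLφ
    (frequently_atTop.2 fun n => ⟨2 * n + 1, by omega, hodd _ (by simp)⟩)
  linarith
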